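/- Let $T>0$, $\xi\in\mathbb{R}^n$, let $U\subset\mathbb{R}^m$ be connected, compact and non-empty, and let $f:[0,T]\times\mathbb{R}^n\times\mathbb{R}^m\to\mathbb{R}^n$ and $\Psi:\mathbb{R}^n\to\mathbb{R}$ be such that $\Psi$ is differentiable on $\mathbb{R}^n$, $f$ is differentiable in $x$ and in $u$ at every point of $[0,T]\times\mathbb{R}^n\times U$, and, for some $L>0$, $\Psi$ and $\nabla\Psi$ are $L$-Lipschitz on $\mathbb{R}^n$ and $f$, $\partial f/\partial x$, $\partial f/\partial u$ are $L$-Lipschitz on $[0,T]\times\mathbb{R}^n\times U$, in the sense that $\|g(t_1,x_1,u_1)-g(t_2,x_2,u_2)\|\le L(|t_1-t_2|+\|x_1-x_2\|+\|u_1-u_2\|)$ for $g=f,\ \partial f/\partial x,\ \partial f/\partial u$ (Euclidean norms and the induced operator norms). A relaxed input is a family $\mu=(\mu_t)_{t\in[0,T]}$ of Borel probability measures on $\mathbb{R}^m$ such that $t\mapsto\mu_t(B)$ is Lebesgue measurable for every Borel set $B$ and $\operatorname{supp}\mu_t\subset U$ for a.e. $t$. All differential equations below are understood in the Carathéodory sense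 (equivalently, in integral form). Let $\mu$ be a relaxed input and let $x=x^{(\mu)}$ be its trajectory, $$\dot x(t)=\int_{\mathbb{R}^m} f(t,x(t),u)\,d\mu_t(u),\qquad x(0)=\xi .$$ An admissible variation of $\mu$ is a family $\delta\mu=(\delta\mu_t)_{t\in[0,T]}$ of finite signed Borel measures on $\mathbb{R}^m$ such that $t\mapsto\delta\mu_t(B)$ is Lebesgue measurable for every Borel set $B$ and, for a.e. $t\in[0,T]$, $$\operatorname{supp}(\delta\mu_t+\mu_t)\subset U,\qquad \delta\mu_t+\mu_t\ge 0,\qquad \int_{\mathbb{R}^m} d\delta\mu_t=0 .$$ Define $$\theta_l(x,\mu)=\min_{(\delta x,\delta\mu)}\ \nabla\Psi(x(T))^{T}\,\delta x(T),$$ the minimum being over all pairs $(\delta x,\delta\mu)$ such that $\delta\mu$ is an admissible variation of $\mu$ and $$\dot{\delta x}(t)=\Big(\int_{\mathbb{R}^m}\frac{\partial f}{\partial x}(t,x(t),u)\,d\mu_t(u)\Big)\delta x(t)+\int_{\mathbb{R}^m} f(t,x(t),u)\,d\delta\mu_t(u),\qquad \delta x(0)=0 .$$ Let $p$ be the costate,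 that is, the solution on $[0,T]$ of $$\dot p(t)=-\Big(\int_{\mathbb{R}^m}\frac{\partial f}{\partial x}(t,x(t),u)^{T}\,d\mu_t(u)\Big)p(t),\qquad p(T)=\nabla\Psi(x(T)),$$ and define $$\theta_h(x,\mu)=\min_{\delta\mu}\ \int_0^T H(t,x(t),\delta\mu_t,p(t))\,dt,\qquad H(t,x,\nu,p)=p^{T}\int_{\mathbb{R}^m} f(t,x,u)\,d\nu(u),$$ the minimum being over all admissible variations $\delta\mu$ of $\mu$. Then the optimality functions $\theta_l$ and $\theta_h$ are equivalent: for every such pair $(x^{(\mu)},\mu)$, the costate exists, both minima are attained, $\theta_l(x,\mu)=\theta_h(x,\mu)$, and the minimizers are the same. That is, the variations $\delta\mu$ that occur in minimizers $(\delta x,\delta\mu)$ of the first problem are exactly the minimizers of the second, and a pair $(\delta x,\delta\mu)$ minimizes the first problem if and only if $\delta\mu$ minimizes the second one and $\delta x$ solves the linearized equation for $\delta\mu$. -/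

import Mathlib

open MeasureTheory Set

noncomputable section

/-- The data of a relaxed optimal control problem with state space `ℝⁿ` and input space `ℝᵐ`:
time horizon `[0, T]`, input set `U`, initial state `ξ`, vector field `f t x u` and final cost
`Ψ`. -/
structure RelaxedProblem (n m : ℕ) where
  T : ℝ
  U : Set (EuclideanSpace ℝ (Fin m))
  ξ : EuclideanSpace ℝ (Fin n)
  f : ℝ → EuclideanSpace ℝ (Fin n) → EuclideanSpace ℝ (Fin m) → EuclideanSpace ℝ (Fin n)
  Ψ : EuclideanSpace ℝ (Fin n) → ℝ

namespace RelaxedProblem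

variable {n m : ℕ}

/-- The Jacobian `∂f/∂x (t, x, u)`, as a continuous linear map. -/
def dfdx (P : RelaxedProblem n m) (t : ℝ) (x : EuclideanSpace ℝ (Fin n))
    (u : EuclideanSpace ℝ (Fin m)) : EuclideanSpace ℝ (Fin n) →L[ℝ] EuclideanSpace ℝ (Fin n) :=
  fderiv ℝ (fun y => P.f t y u) x

/-- The Jacobian `∂f/∂u (t, x, u)`, as a continuous linear map. -/
def dfdu (P : RelaxedProblem n m) (t : ℝ) (x : EuclideanSpace ℝ (Fin n))
    (u : EuclideanSpace ℝ (Fin m)) : EuclideanSpace ℝ (Fin m) →L[ℝ] EuclideanSpace ℝ (Fin n) :=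
  fderiv ℝ (fun v => P.f t x v) u

/-- `f` and `Ψ` are Lipschitz continuously differentiable (on `[0, T] × ℝⁿ × U` and on `ℝⁿ`):
the functions and their first derivatives in `x` and `u` are Lipschitz. All norms are Euclidean
norms and the operator norms that they induce. -/
def LipschitzC1 (P : RelaxedProblem n m) : Prop :=
  Differentiable ℝ P.Ψ ∧
  (∀ t ∈ Icc 0 P.T, ∀ x, ∀ u ∈ P.U,
    DifferentiableAt ℝ (fun y => P.f t y u) x ∧ DifferentiableAt ℝ (fun v => P.f t x v) u) ∧
  ∃ L : ℝ, 0 < L ∧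
    (∀ x₁ x₂, |P.Ψ x₁ - P.Ψ x₂| ≤ L * ‖x₁ - x₂‖) ∧
    (∀ x₁ x₂, ‖gradient P.Ψ x₁ - gradient P.Ψ x₂‖ ≤ L * ‖x₁ - x₂‖) ∧
    ∀ t₁ ∈ Icc 0 P.T, ∀ t₂ ∈ Icc 0 P.T, ∀ x₁ x₂, ∀ u₁ ∈ P.U, ∀ u₂ ∈ P.U,
      ‖P.f t₁ x₁ u₁ - P.f t₂ x₂ u₂‖ ≤ L * (|t₁ - t₂| + ‖x₁ - x₂‖ + ‖u₁ - u₂‖) ∧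
      ‖P.dfdx t₁ x₁ u₁ - P.dfdx t₂ x₂ u₂‖ ≤ L * (|t₁ - t₂| + ‖x₁ - x₂‖ + ‖u₁ - u₂‖) ∧
      ‖P.dfdu t₁ x₁ u₁ - P.dfdu t₂ x₂ u₂‖ ≤ L * (|t₁ - t₂| + ‖x₁ - x₂‖ + ‖u₁ - u₂‖)

/-- `μ` is a relaxed input: `t ↦ μ_t` is (Lebesgue) measurable on `[0, T]`, and
`supp μ_t ⊆ U` for almost every `t ∈ [0, T]`. -/
def IsRelaxedInput (P : RelaxedProblem n m)
    (μ : ℝ → ProbabilityMeasure (EuclideanSpace ℝ (Fin m))) : Prop :=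
  (∀ B, MeasurableSet B → AEMeasurable
    (fun t => (μ t : Measure (EuclideanSpace ℝ (Fin m))) B) (volume.restrict (Icc 0 P.T))) ∧
  ∀ᵐ t ∂(volume.restrict (Icc 0 P.T)),
    (μ t : Measure (EuclideanSpace ℝ (Fin m))).support ⊆ P.U

/-- `x` is, on `[0, T]`, a trajectory of the relaxed input `μ`: the (Carathéodory) solution of
`x' (t) = ∫ f (t, x t, u) dμ_t(u)`, `x 0 = ξ`, in integral form. -/
def IsTrajectory (P : RelaxedProblem n m)
    (μ : ℝ → ProbabilityMeasure (EuclideanSpace ℝ (Fin m)))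
    (x : ℝ → EuclideanSpace ℝ (Fin n)) : Prop :=
  IntervalIntegrable
    (fun s => ∫ u, P.f s (x s) u ∂(μ s : Measure (EuclideanSpace ℝ (Fin m)))) volume 0 P.T ∧
  ∀ t ∈ Icc 0 P.T, x t = P.ξ +
    ∫ s in (0 : ℝ)..t, ∫ u, P.f s (x s) u ∂(μ s : Measure (EuclideanSpace ℝ (Fin m)))

/-- `p` is, on `[0, T]`, a costate along `(x, μ)`: the (Carathéodory) solution of
`p' (t) = - (∫ (∂f/∂x (t, x t, u))ᵀ dμ_t(u)) (p t)`, `p T = ∂Ψ/∂x (x T)`, in integral form. -/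
def IsCostate (P : RelaxedProblem n m)
    (x : ℝ → EuclideanSpace ℝ (Fin n))
    (μ : ℝ → ProbabilityMeasure (EuclideanSpace ℝ (Fin m)))
    (p : ℝ → EuclideanSpace ℝ (Fin n)) : Prop :=
  IntervalIntegrable
    (fun s => (∫ u, ContinuousLinearMap.adjoint (P.dfdx s (x s) u)
      ∂(μ s : Measure (EuclideanSpace ℝ (Fin m)))) (p s)) volume 0 P.T ∧
  ∀ t ∈ Icc 0 P.T, p t = gradient P.Ψ (x P.T) +
    ∫ s in t..P.T, (∫ u, ContinuousLinearMap.adjoint (P.dfdx s (x s) u)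
      ∂(μ s : Measure (EuclideanSpace ℝ (Fin m)))) (p s)

/-- `δμ` is an admissible variation of the relaxed input `μ`: it is a (Lebesgue) measurable
family of signed measures, and for almost every `t ∈ [0, T]`, `supp (δμ_t + μ_t) ⊆ U`,
`δμ_t + μ_t ≥ 0` and `∫ dδμ_t = 0`. -/
def IsVariation (P : RelaxedProblem n m)
    (μ : ℝ → ProbabilityMeasure (EuclideanSpace ℝ (Fin m)))
    (δμ : ℝ → SignedMeasure (EuclideanSpace ℝ (Fin m))) : Prop :=
  (∀ B, MeasurableSet B → AEMeasurable (fun t => δμ t B) (volume.restrict (Icc 0 P.T))) ∧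
  ∀ᵐ t ∂(volume.restrict (Icc 0 P.T)),
    (δμ t + (μ t : Measure (EuclideanSpace ℝ (Fin m))).toSignedMeasure).variation.support ⊆ P.U ∧
    0 ≤ δμ t + (μ t : Measure (EuclideanSpace ℝ (Fin m))).toSignedMeasure ∧
    δμ t univ = 0

/-- `δx` is, on `[0, T]`, the (Carathéodory) solution, in integral form, of the dynamics
linearized along `(x, μ)`: `δx' (t) = (∫ ∂f/∂x (t, x t, u) dμ_t(u)) (δx t) + ∫ f (t, x t, u) dδμ_t(u)`,
`δx 0 = 0`. -/
def IsLinearizedTrajectory (P : RelaxedProblem n m)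
    (x : ℝ → EuclideanSpace ℝ (Fin n))
    (μ : ℝ → ProbabilityMeasure (EuclideanSpace ℝ (Fin m)))
    (δμ : ℝ → SignedMeasure (EuclideanSpace ℝ (Fin m)))
    (δx : ℝ → EuclideanSpace ℝ (Fin n)) : Prop :=
  IntervalIntegrable
    (fun s => (∫ u, P.dfdx s (x s) u ∂(μ s : Measure (EuclideanSpace ℝ (Fin m)))) (δx s)
      + ∫ᵛ u, P.f s (x s) u ∂<•(δμ s)) volume 0 P.T ∧
  ∀ t ∈ Icc 0 P.T, δx t =
    ∫ s in (0 : ℝ)..t,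
      ((∫ u, P.dfdx s (x s) u ∂(μ s : Measure (EuclideanSpace ℝ (Fin m)))) (δx s)
        + ∫ᵛ u, P.f s (x s) u ∂<•(δμ s))

/-- The feasible set of the linearized problem: pairs `(δx, δμ)`. -/
def linFeasible (P : RelaxedProblem n m) (x : ℝ → EuclideanSpace ℝ (Fin n))
    (μ : ℝ → ProbabilityMeasure (EuclideanSpace ℝ (Fin m))) :
    Set ((ℝ → EuclideanSpace ℝ (Fin n)) × (ℝ → SignedMeasure (EuclideanSpace ℝ (Fin m)))) :=
  {z | P.IsVariation μ z.2 ∧ P.IsLinearizedTrajectory x μ z.2 z.1}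

/-- The cost `∂Ψ/∂x (x T)ᵀ δx T` of the linearized problem. -/
def linCost (P : RelaxedProblem n m) (x : ℝ → EuclideanSpace ℝ (Fin n))
    (z : (ℝ → EuclideanSpace ℝ (Fin n)) × (ℝ → SignedMeasure (EuclideanSpace ℝ (Fin m)))) : ℝ :=
  inner ℝ (gradient P.Ψ (x P.T)) (z.1 P.T)

/-- The optimality function `θ_l`: the optimal value of the linearized problem. -/
def thetaL (P : RelaxedProblem n m) (x : ℝ → EuclideanSpace ℝ (Fin n))
    (μ : ℝ → ProbabilityMeasure (EuclideanSpace ℝ (Fin m))) : ℝ :=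
  sInf (P.linCost x '' P.linFeasible x μ)

/-- The minimizers `(δx, δμ)` of the linearized problem. -/
def linMinimizers (P : RelaxedProblem n m) (x : ℝ → EuclideanSpace ℝ (Fin n))
    (μ : ℝ → ProbabilityMeasure (EuclideanSpace ℝ (Fin m))) :
    Set ((ℝ → EuclideanSpace ℝ (Fin n)) × (ℝ → SignedMeasure (EuclideanSpace ℝ (Fin m)))) :=
  {z ∈ P.linFeasible x μ | IsMinOn (P.linCost x) (P.linFeasible x μ) z}

/-- The Hamiltonian `H (t, x, ν, p) = pᵀ ∫ f (t, x, u) dν(u)` of a signed measure `ν`. -/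
def hamiltonian (P : RelaxedProblem n m) (t : ℝ) (x : EuclideanSpace ℝ (Fin n))
    (ν : SignedMeasure (EuclideanSpace ℝ (Fin m))) (p : EuclideanSpace ℝ (Fin n)) : ℝ :=
  inner ℝ p (∫ᵛ u, P.f t x u ∂<•ν)

/-- The feasible set of the Hamiltonian problem. -/
def hamFeasible (P : RelaxedProblem n m)
    (μ : ℝ → ProbabilityMeasure (EuclideanSpace ℝ (Fin m))) :
    Set (ℝ → SignedMeasure (EuclideanSpace ℝ (Fin m))) :=
  {δμ | P.IsVariation μ δμ}

/-- The cost `∫₀ᵀ H (t, x t, δμ_t, p t) dt` of the Hamiltonian problem. -/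
def hamCost (P : RelaxedProblem n m) (x p : ℝ → EuclideanSpace ℝ (Fin n))
    (δμ : ℝ → SignedMeasure (EuclideanSpace ℝ (Fin m))) : ℝ :=
  ∫ t in (0 : ℝ)..P.T, P.hamiltonian t (x t) (δμ t) (p t)

/-- The optimality function `θ_h`: the optimal value of the Hamiltonian problem, where `p` is the
costate along `(x, μ)`. -/
def thetaH (P : RelaxedProblem n m) (x : ℝ → EuclideanSpace ℝ (Fin n))
    (μ : ℝ → ProbabilityMeasure (EuclideanSpace ℝ (Fin m)))
    (p : ℝ → EuclideanSpace ℝ (Fin n)) : ℝ :=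
  sInf (P.hamCost x p '' P.hamFeasible μ)

/-- The minimizers `δμ` of the Hamiltonian problem. -/
def hamMinimizers (P : RelaxedProblem n m) (x : ℝ → EuclideanSpace ℝ (Fin n))
    (μ : ℝ → ProbabilityMeasure (EuclideanSpace ℝ (Fin m)))
    (p : ℝ → EuclideanSpace ℝ (Fin n)) :
    Set (ℝ → SignedMeasure (EuclideanSpace ℝ (Fin m))) :=
  {δμ ∈ P.hamFeasible μ | IsMinOn (P.hamCost x p) (P.hamFeasible μ) δμ}

end RelaxedProblem

end


/-!
The costate solves the adjoint of the linearized dynamics, so along every feasible pair `(δx, δμ)`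
the derivative of `⟨p, δx⟩` is almost everywhere `H(t, x, δμ_t, p)`. Integrating from `δx(0) = 0` to
`p(T) = ∇Ψ(x(T))` shows that the two costs agree on feasible pairs. The linearized equation is a
linear Carathéodory equation, solvable for every admissible variation; hence both problems minimize
the same function of `δμ` and share their value and their minimizers.

Up to a null set of times, the admissible variations of `μ` are the differences `ν - μ` of relaxed
inputs, and the Hamiltonian cost of `ν - μ` is the integral of `⟨p, f(t, x, ·)⟩` against `ν`, minus
a constant. It is minimized pointwise in time by Dirac masses at a measurable selection `s(t)` of
minimizers of `u ↦ ⟨p(t), f(t, x(t), u)⟩` over `U`.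
-/

section MeasurableSelection

theorem isCompact_fiber {X Y : Type*} [TopologicalSpace X] [T1Space X] [TopologicalSpace Y]
    {S : Set (X × Y)} (hS : IsCompact S) (t : X) : IsCompact {y | (t, y) ∈ S} := by
  have h_fiber : {y | (t, y) ∈ S} = Prod.snd '' (S ∩ Prod.fst ⁻¹' {t}) := by
    ext y
    simp
  rw [h_fiber]
  exact (hS.inter_right (isClosed_singleton.preimage continuous_fst)).image continuous_snd

variable {X : Type*} [TopologicalSpace X] [T2Space X] [MeasurableSpace X] [OpensMeasurableSpace X]

theorem measurable_sInf_fiber {S : Set (X × ℝ)} (hS : IsCompact S) :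
    Measurable fun t => sInf {c | (t, c) ∈ S} := by
  have measurableSet_fst : ∀ {K : Set (X × ℝ)}, IsCompact K → MeasurableSet (Prod.fst '' K) :=
    fun hK => (hK.image continuous_fst).isClosed.measurableSet
  refine measurable_of_Iic fun a => ?_
  have h_preimage : (fun t => sInf {c | (t, c) ∈ S}) ⁻¹' Iic a =
      Prod.fst '' (S ∩ {q | q.2 ≤ a}) ∪ ((Prod.fst '' S)ᶜ ∩ {_t | (0 : ℝ) ≤ a}) := by
    ext t
    rcases {c | (t, c) ∈ S}.eq_empty_or_nonempty with hempty | hne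
    · have hnot : ∀ c, (t, c) ∉ S := fun c hc => hempty.subset hc
      simp [hnot]
    · have hmem := (isCompact_fiber hS t).sInf_mem hne
      have hproj : t ∈ Prod.fst '' S := ⟨(t, _), hmem, rfl⟩
      suffices sInf {c | (t, c) ∈ S} ≤ a ↔ ∃ c, (t, c) ∈ S ∧ c ≤ a by simpa [hproj] using this
      exact ⟨fun h => ⟨_, hmem, h⟩,
        fun ⟨c, hc, hca⟩ => (csInf_le (isCompact_fiber hS t).bddBelow hc).trans hca⟩
  rw [h_preimage]
  exact (measurableSet_fst (hS.inter_right (isClosed_le continuous_snd continuous_const))).union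
    ((measurableSet_fst hS).compl.inter (MeasurableSet.const _))

theorem exists_measurable_selection_of_isCompact {E : Type*} [MetricSpace E] [MeasurableSpace E]
    [BorelSpace E] [Nonempty E] {S : Set (X × E)} (hS : IsCompact S) :
    ∃ s : X → E, Measurable s ∧ ∀ t ∈ Prod.fst '' S, (t, s t) ∈ S := by
  rcases S.eq_empty_or_nonempty with rfl | hne
  · exact ⟨fun _ => Classical.arbitrary E, measurable_const, by simp⟩
  have : Nonempty (Prod.snd '' S) := (hne.image _).to_subtype
  have : CompactSpace (Prod.snd '' S) := isCompact_iff_compactSpace.1 (hS.image continuous_snd)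
  have : CompactSpace cantorSet := isCompact_iff_compactSpace.1 isCompact_cantorSet
  -- Parametrizing `S` by the Cantor set orders each of its fibers, so that we can select the point
  -- with the least parameter.
  obtain ⟨φ, hφ, hφ_surj⟩ := exists_nat_bool_continuous_surjective_of_compact (Prod.snd '' S)
  let ψ : cantorSet → E := fun c => φ (cantorSetHomeomorphNatToBool c)
  have hψ : Continuous ψ := by fun_prop
  obtain ⟨ψ', hψ', hψ'ψ⟩ := (MeasurableEmbedding.subtype_coe
    isClosed_cantorSet.measurableSet).exists_measurable_extend hψ.measurable fun _ => ‹Nonempty E›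
  let R : Set (X × ℝ) := (fun q : X × cantorSet => (q.1, (q.2 : ℝ))) '' {q | (q.1, ψ q.2) ∈ S}
  have hR : IsCompact R :=
    (((hS.image continuous_fst).prod isCompact_univ).of_isClosed_subset
      (hS.isClosed.preimage (by fun_prop : Continuous fun q : X × cantorSet => (q.1, ψ q.2)))
      fun q hq => ⟨⟨_, hq, rfl⟩, mem_univ _⟩).image (by fun_prop)
  refine ⟨fun t => ψ' (sInf {c | (t, c) ∈ R}), hψ'.comp (measurable_sInf_fiber hR), ?_⟩
  rintro _ ⟨⟨t, u⟩, htu, rfl⟩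
  have hfiber : {c | (t, c) ∈ R}.Nonempty := by
    obtain ⟨b, hb⟩ := hφ_surj ⟨u, (t, u), htu, rfl⟩
    exact ⟨_, (t, cantorSetHomeomorphNatToBool.symm b), by simpa [ψ, hb] using htu, rfl⟩
  obtain ⟨⟨t', c⟩, hc, hc_eq⟩ := (isCompact_fiber hR t).sInf_mem hfiber
  obtain ⟨rfl, hc_inf⟩ := Prod.mk.inj hc_eq
  change (t', ψ' (sInf {c | (t', c) ∈ R})) ∈ S
  rw [← hc_inf]
  rwa [show ψ' c = ψ c from congrFun hψ'ψ c]

theorem exists_measurable_argmin {E : Type*} [MetricSpace E] [MeasurableSpace E] [BorelSpace E]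
    {I : Set X} {U : Set E} (hI : IsCompact I) (hU : IsCompact U) (hne : U.Nonempty)
    {g : X → E → ℝ} (hg : ContinuousOn (Function.uncurry g) (I ×ˢ U)) :
    ∃ s : X → E, Measurable s ∧ ∀ t ∈ I, s t ∈ U ∧ IsMinOn (g t) U (s t) := by
  have : Nonempty E := hne.to_type
  let S : Set (X × E) := ⋂ v : U, {q ∈ I ×ˢ U | g q.1 q.2 ≤ g q.1 v}
  have hS_mem : ∀ {q}, q ∈ S ↔ q ∈ I ×ˢ U ∧ IsMinOn (g q.1) U q.2 := by
    have : Nonempty U := hne.to_subtype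
    simp [S, forall_and, isMinOn_iff]
  have hS : IsCompact S := by
    refine (hI.prod hU).of_isClosed_subset (isClosed_iInter fun v => ?_) fun q hq => (hS_mem.1 hq).1
    exact (hI.isClosed.prod hU.isClosed).isClosed_le hg
      (hg.comp (f := fun q : X × E => (q.1, (v : E))) (by fun_prop) fun _ hq => ⟨hq.1, v.2⟩)
  obtain ⟨s, hs, hs_mem⟩ := exists_measurable_selection_of_isCompact hS
  refine ⟨s, hs, fun t ht => ?_⟩
  obtain ⟨u, hu, hmin⟩ := hU.exists_isMinOn hne
    (hg.comp (f := fun u => (t, u)) (by fun_prop) fun u hu => ⟨ht, hu⟩)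
  have := hS_mem.1 (hs_mem t ⟨(t, u), hS_mem.2 ⟨⟨ht, hu⟩, hmin⟩, rfl⟩)
  exact ⟨this.1.2, this.2⟩

end MeasurableSelection

section MeasurableFamilies

open ProbabilityTheory

variable {Ω E F : Type*} [MeasurableSpace Ω] [MeasurableSpace E] [NormedAddCommGroup F]

theorem exists_markovKernel_ae_eq [MeasurableSpace.CountablyGenerated E] {ρ : Measure Ω}
    {μ : Ω → ProbabilityMeasure E}
    (hμ : ∀ B, MeasurableSet B → AEMeasurable (fun t => (μ t : Measure E) B) ρ) :
    ∃ κ : Kernel Ω E, IsMarkovKernel κ ∧ ∀ᵐ t ∂ρ, κ t = μ t := by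
  classical
  rcases isEmpty_or_nonempty Ω with hΩ | ⟨⟨t₀⟩⟩
  · exact ⟨⟨isEmptyElim, measurable_of_empty _⟩, ⟨isEmptyElim⟩, .of_forall isEmptyElim⟩
  let C := generateSetAlgebra (MeasurableSpace.countableGeneratingSet E)
  have hC_gen : ‹MeasurableSpace E› = MeasurableSpace.generateFrom C := by
    rw [generateFrom_generateSetAlgebra_eq, MeasurableSpace.generateFrom_countableGeneratingSet]
  have hC_meas : ∀ B ∈ C, MeasurableSet B := fun B hB =>
    hC_gen ▸ MeasurableSpace.measurableSet_generateFrom hB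
  have hC_pi : IsPiSystem C := fun s hs t ht _ => isSetAlgebra_generateSetAlgebra.inter_mem hs ht
  have hC_count : Countable C := (countable_generateSetAlgebra
    MeasurableSpace.countable_countableGeneratingSet).to_subtype
  obtain ⟨N, hN_sub, hN, hN_null⟩ := exists_measurable_superset_of_null <|
    ae_all_iff.2 fun B : C => (hμ B (hC_meas B B.2)).ae_eq_mk
  let κ : Ω → Measure E := fun t => if t ∈ N then μ t₀ else μ t
  have hκ_prob : ∀ t, IsProbabilityMeasure (κ t) := fun t => by
    by_cases ht : t ∈ N <;> simp only [κ, ht, if_true, if_false] <;> infer_instance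
  have hκ : Measurable κ := by
    refine Measurable.measure_of_isPiSystem_of_isProbabilityMeasure hC_gen hC_pi fun B hB => ?_
    have hκ_apply : (fun t => κ t B) =
        fun t => if t ∈ N then (μ t₀ : Measure E) B else (hμ B (hC_meas B hB)).mk _ t := by
      ext t
      by_cases ht : t ∈ N
      · simp only [κ, ht, if_true]
      · have := not_not.1 fun h => ht (hN_sub h)
        simpa only [κ, ht, if_false] using this ⟨B, hB⟩
    rw [hκ_apply]
    exact Measurable.ite hN measurable_const (hμ B (hC_meas B hB)).measurable_mk
  refine ⟨⟨κ, hκ⟩, ⟨hκ_prob⟩, ?_⟩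
  filter_upwards [measure_eq_zero_iff_ae_notMem.1 hN_null] with t ht
  exact if_neg ht

theorem integrable_of_continuousOn_of_ae_mem [TopologicalSpace E] [T2Space E]
    [OpensMeasurableSpace E] {μ : Measure E} [IsFiniteMeasure μ] {U : Set E} (hU : IsCompact U)
    {g : E → F} (hg : ContinuousOn g U) (hμ : ∀ᵐ u ∂μ, u ∈ U) : Integrable g μ := by
  rw [← Measure.restrict_eq_self_of_ae_mem hμ]
  exact hg.integrableOn_compact hU

theorem integrable_integral_of_continuousOn [TopologicalSpace Ω] [T2Space Ω]
    [OpensMeasurableSpace Ω] [TopologicalSpace E] [T2Space E] [SecondCountableTopology E]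
    [BorelSpace E] [NormedSpace ℝ F] {ρ : Measure Ω} [IsFiniteMeasure ρ]
    {μ : Ω → ProbabilityMeasure E}
    (hμ : ∀ B, MeasurableSet B → AEMeasurable (fun t => (μ t : Measure E) B) ρ)
    {I : Set Ω} {U : Set E} (hI : IsCompact I) (hU : IsCompact U) {g : Ω → E → F}
    (hg : ContinuousOn (Function.uncurry g) (I ×ˢ U)) (hρI : ∀ᵐ t ∂ρ, t ∈ I)
    (hμU : ∀ᵐ t ∂ρ, ∀ᵐ u ∂(μ t : Measure E), u ∈ U) :
    Integrable (fun t => ∫ u, g t u ∂(μ t : Measure E)) ρ := by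
  obtain ⟨κ, _, hκμ⟩ := exists_markovKernel_ae_eq hμ
  have h_mem : ∀ᵐ q ∂(ρ ⊗ₘ κ), q ∈ I ×ˢ U := by
    refine Measure.ae_compProd_of_ae_ae (hI.measurableSet.prod hU.measurableSet) ?_
    filter_upwards [hρI, hμU, hκμ] with t ht hμt hκt
    rw [hκt]
    exact hμt.mono fun u hu => ⟨ht, hu⟩
  have h_int := (integrable_of_continuousOn_of_ae_mem (hI.prod hU) hg h_mem).integral_compProd
  refine Integrable.congr h_int ?_
  filter_upwards [hκμ] with t ht
  simp [ht]

end MeasurableFamilies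

section AbsoluteContinuity

variable {E : Type*} [NormedAddCommGroup E] {a b : ℝ}

theorem absolutelyContinuousOnInterval_of_dist_le {X Y : Type*} [PseudoMetricSpace X]
    [PseudoMetricSpace Y] {f : ℝ → X} {g : ℝ → Y} {K : ℝ}
    (hg : AbsolutelyContinuousOnInterval g a b)
    (hfg : ∀ x ∈ uIcc a b, ∀ y ∈ uIcc a b, dist (f x) (f y) ≤ K * dist (g x) (g y)) :
    AbsolutelyContinuousOnInterval f a b := by
  refine squeeze_zero' (.of_forall fun _ => Finset.sum_nonneg fun _ _ => dist_nonneg) ?_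
    (by simpa using Filter.Tendsto.const_mul K hg)
  filter_upwards [Filter.mem_inf_of_right (Filter.mem_principal_self _)] with D hD
  rw [Finset.mul_sum]
  exact Finset.sum_le_sum fun i hi => hfg _ (hD.1 i hi).1 _ (hD.1 i hi).2

theorem absolutelyContinuousOnInterval_norm {f : ℝ → E}
    (hf : AbsolutelyContinuousOnInterval f a b) :
    AbsolutelyContinuousOnInterval (fun t => ‖f t‖) a b :=
  absolutelyContinuousOnInterval_of_dist_le (K := 1) hf fun x _ y _ => by
    simpa [dist_eq_norm] using abs_norm_sub_norm_le (f x) (f y)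

theorem absolutelyContinuousOnInterval_intervalIntegral [NormedSpace ℝ E] {f : ℝ → E} {c : ℝ}
    (hf : IntervalIntegrable f volume a b) (hc : c ∈ uIcc a b) :
    AbsolutelyContinuousOnInterval (fun t => ∫ s in c..t, f s) a b := by
  refine absolutelyContinuousOnInterval_of_dist_le (K := 1)
    (hf.norm.absolutelyContinuousOnInterval_intervalIntegral hc) fun x hx y hy => ?_
  have hf_cx := hf.mono_set (uIcc_subset_uIcc hc hx)
  have hf_cy := hf.mono_set (uIcc_subset_uIcc hc hy)
  rw [one_mul, dist_eq_norm, dist_eq_norm, Real.norm_eq_abs,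
    intervalIntegral.integral_interval_sub_left hf_cx hf_cy,
    intervalIntegral.integral_interval_sub_left hf_cx.norm hf_cy.norm]
  exact intervalIntegral.norm_integral_le_abs_integral_norm

theorem absolutelyContinuousOnInterval_comp_of_contDiff {V W : Type*} [NormedAddCommGroup V]
    [NormedSpace ℝ V] [ProperSpace V] [NormedAddCommGroup W] [NormedSpace ℝ W] {φ : V → W}
    {f : ℝ → V} (hφ : ContDiff ℝ 1 φ) (hf : AbsolutelyContinuousOnInterval f a b) :
    AbsolutelyContinuousOnInterval (fun t => φ (f t)) a b := by
  obtain ⟨C, hC⟩ := hf.exists_bound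
  obtain ⟨K, hK⟩ := hφ.contDiffOn.exists_lipschitzOnWith one_ne_zero (convex_closedBall 0 C)
    (isCompact_closedBall 0 C)
  exact absolutelyContinuousOnInterval_of_dist_le hf fun x hx y hy =>
    hK.dist_le_mul _ (by simpa using hC x hx) _ (by simpa using hC y hy)

theorem integral_mul_exp_integral {f : ℝ → ℝ} (hf : IntervalIntegrable f volume a b) :
    ∫ t in a..b, f t * Real.exp (∫ s in a..t, f s) = Real.exp (∫ t in a..b, f t) - 1 := by
  have h_ac := absolutelyContinuousOnInterval_comp_of_contDiff Real.contDiff_exp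
    (absolutelyContinuousOnInterval_intervalIntegral hf left_mem_uIcc)
  have h_ftc := h_ac.integral_deriv_eq_sub
  rw [intervalIntegral.integral_same, Real.exp_zero] at h_ftc
  rw [← h_ftc]
  refine intervalIntegral.integral_congr_ae ?_
  filter_upwards [hf.ae_hasDerivAt_integral] with t hft ht
  rw [mul_comm]
  exact (hft (uIoc_subset_uIcc ht) a left_mem_uIcc).exp.deriv.symm

variable [InnerProductSpace ℝ E]

theorem absolutelyContinuousOnInterval_inner {f g : ℝ → E}
    (hf : AbsolutelyContinuousOnInterval f a b) (hg : AbsolutelyContinuousOnInterval g a b) :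
    AbsolutelyContinuousOnInterval (fun t => inner ℝ (f t) (g t)) a b := by
  have h_sq : ∀ {h : ℝ → E}, AbsolutelyContinuousOnInterval h a b →
      AbsolutelyContinuousOnInterval (fun t => ‖h t‖ * ‖h t‖) a b := fun hh =>
    (absolutelyContinuousOnInterval_norm hh).fun_mul (absolutelyContinuousOnInterval_norm hh)
  simp_rw [real_inner_eq_norm_add_mul_self_sub_norm_mul_self_sub_norm_mul_self_div_two,
    div_eq_inv_mul]
  exact (((h_sq (hf.fun_add hg)).fun_sub (h_sq hf)).fun_sub (h_sq hg)).const_mul _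

theorem integral_inner_add_inner_of_eq_primitive [CompleteSpace E] {f g F G : ℝ → E} {a₀ b₀ : E}
    (hf : IntervalIntegrable f volume a b) (hg : IntervalIntegrable g volume a b)
    (hF : ∀ t ∈ uIcc a b, F t = a₀ + ∫ s in a..t, f s)
    (hG : ∀ t ∈ uIcc a b, G t = b₀ + ∫ s in a..t, g s) :
    ∫ t in a..b, (inner ℝ (f t) (G t) + inner ℝ (F t) (g t)) =
      inner ℝ (F b) (G b) - inner ℝ (F a) (G a) := by
  have h_ac : ∀ {h : ℝ → E} (c : E), IntervalIntegrable h volume a b →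
      AbsolutelyContinuousOnInterval (fun t => c + ∫ s in a..t, h s) a b := fun c hh =>
    (LipschitzWith.const c).lipschitzOnWith.absolutelyContinuousOnInterval.fun_add
      (absolutelyContinuousOnInterval_intervalIntegral hh left_mem_uIcc)
  rw [hF a left_mem_uIcc, hF b right_mem_uIcc, hG a left_mem_uIcc, hG b right_mem_uIcc,
    ← (absolutelyContinuousOnInterval_inner (h_ac a₀ hf) (h_ac b₀ hg)).integral_deriv_eq_sub]
  refine intervalIntegral.integral_congr_ae ?_
  filter_upwards [hf.ae_hasDerivAt_integral, hg.ae_hasDerivAt_integral] with t hft hgt ht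
  have ht := uIoc_subset_uIcc ht
  rw [hF t ht, hG t ht, add_comm]
  exact (((hft ht a left_mem_uIcc).const_add a₀).inner ℝ
    ((hgt ht a left_mem_uIcc).const_add b₀)).deriv.symm

end AbsoluteContinuity

section LinearCaratheodory

variable {E F : Type*} [NormedAddCommGroup E] [NormedSpace ℝ E] [NormedAddCommGroup F]
  [NormedSpace ℝ F] {a b : ℝ}

theorem intervalIntegrable_clm_apply {A : ℝ → E →L[ℝ] F} {y : ℝ → E}
    (hA : IntervalIntegrable A volume a b) (hy : ContinuousOn y (uIcc a b)) :
    IntervalIntegrable (fun s => A s (y s)) volume a b := by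
  obtain ⟨C, hC⟩ := isCompact_uIcc.exists_bound_of_continuousOn hy
  rw [intervalIntegrable_iff] at hA ⊢
  refine (ContinuousLinearMap.id ℝ (E →L[ℝ] F)).integrable_of_bilin_of_bdd_right C hA
    ((hy.mono uIoc_subset_uIcc).aestronglyMeasurable measurableSet_uIoc) ?_
  filter_upwards [ae_restrict_mem measurableSet_uIoc] with s hs
  exact hC s (uIoc_subset_uIcc hs)

theorem norm_integral_clm_apply_le {A : ℝ → E →L[ℝ] F} {z : ℝ → E} {C : ℝ} (hab : a ≤ b)
    (hA : IntervalIntegrable A volume a b) (hC : 0 ≤ C)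
    (hz : ∀ t ∈ Icc a b, ‖z t‖ ≤ C * Real.exp (2 * ∫ s in a..t, ‖A s‖)) :
    ‖∫ s in a..b, A s (z s)‖ ≤ C / 2 * Real.exp (2 * ∫ s in a..b, ‖A s‖) := by
  have h_int : IntervalIntegrable (fun t => 2 * ‖A t‖) volume a b := hA.norm.const_mul 2
  have h_exp := integral_mul_exp_integral h_int
  simp only [intervalIntegral.integral_const_mul] at h_exp
  have h_cont : ContinuousOn (fun t => Real.exp (2 * ∫ s in a..t, ‖A s‖)) (uIcc a b) :=
    ((intervalIntegral.continuousOn_primitive_interval' hA.norm left_mem_uIcc).const_mul 2).rexp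
  calc ‖∫ s in a..b, A s (z s)‖
      ≤ ∫ t in a..b, C / 2 * (2 * ‖A t‖ * Real.exp (2 * ∫ s in a..t, ‖A s‖)) := by
        refine intervalIntegral.norm_integral_le_of_norm_le hab (.of_forall fun t ht => ?_)
          ((h_int.mul_continuousOn h_cont).const_mul _)
        calc ‖A t (z t)‖ ≤ ‖A t‖ * (C * Real.exp (2 * ∫ s in a..t, ‖A s‖)) :=
              (A t).le_opNorm_of_le (hz t (Ioc_subset_Icc_self ht))
          _ = _ := by ring
    _ = C / 2 * (Real.exp (2 * ∫ s in a..b, ‖A s‖) - 1) := by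
        rw [intervalIntegral.integral_const_mul, h_exp]
    _ ≤ _ := by gcongr; linarith

theorem continuousOn_Icc_primitive (hab : a ≤ b) {h : ℝ → E}
    (hh : IntervalIntegrable h volume a b) :
    ContinuousOn (fun t => ∫ s in a..t, h s) (Icc a b) := by
  simpa only [uIcc_of_le hab] using
    intervalIntegral.continuousOn_primitive_interval' hh left_mem_uIcc

theorem exists_eq_of_weighted_contraction {X : Type*} [TopologicalSpace X] [CompleteSpace E]
    {S : Set X} (hS : IsCompact S) {w : X → ℝ} (hw : ContinuousOn w S) (hw_pos : ∀ t ∈ S, 0 < w t)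
    {K : NNReal} (hK : K < 1) {Φ : (X → E) → X → E}
    (hΦ_cont : ∀ y, ContinuousOn y S → ContinuousOn (Φ y) S)
    (hΦ : ∀ y z, ContinuousOn y S → ContinuousOn z S → ∀ C, 0 ≤ C →
      (∀ t ∈ S, ‖y t - z t‖ ≤ C * w t) → ∀ t ∈ S, ‖Φ y t - Φ z t‖ ≤ K * C * w t) :
    ∃ y, ContinuousOn y S ∧ ∀ t ∈ S, y t = Φ y t := by
  have : CompactSpace S := isCompact_iff_compactSpace.1 hS
  let Y : C(S, E) → X → E := fun z => Function.extend (↑) (fun t : S => w t • z t) 0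
  have hY : ∀ z (t : S), Y z t = w t • z t := fun z t => Subtype.val_injective.extend_apply _ _ _
  have hY_cont : ∀ z, ContinuousOn (Y z) S := fun z => by
    rw [continuousOn_iff_continuous_domRestrict] at hw ⊢
    exact (hw.smul z.continuous).congr fun t => (hY z t).symm
  have hY_sub : ∀ z z', ∀ t ∈ S, ‖Y z t - Y z' t‖ ≤ dist z z' * w t := fun z z' t ht => by
    have hw_nonneg := (hw_pos t ht).le
    rw [hY z ⟨t, ht⟩, hY z' ⟨t, ht⟩, ← smul_sub, norm_smul_of_nonneg hw_nonneg, mul_comm,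
      ← dist_eq_norm]
    exact mul_le_mul_of_nonneg_right (ContinuousMap.dist_apply_le_dist _) hw_nonneg
  let Φ' : C(S, E) → C(S, E) := fun z => ⟨S.domRestrict fun t => (w t)⁻¹ • Φ (Y z) t,
    ((hw.inv₀ fun t ht => (hw_pos t ht).ne').smul (hΦ_cont _ (hY_cont z))).domRestrict⟩
  have hΦ' : ContractingWith K Φ' := by
    refine ⟨hK, LipschitzWith.of_dist_le_mul fun z z' =>
      (ContinuousMap.dist_le (by positivity)).2 fun ⟨t, ht⟩ => ?_⟩
    calc dist (Φ' z ⟨t, ht⟩) (Φ' z' ⟨t, ht⟩) = (w t)⁻¹ * ‖Φ (Y z) t - Φ (Y z') t‖ := by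
          rw [dist_eq_norm, ← norm_smul_of_nonneg (inv_nonneg.2 (hw_pos t ht).le), smul_sub]
          rfl
      _ ≤ K * dist z z' := by
          rw [inv_mul_le_iff₀ (hw_pos t ht), mul_comm]
          exact hΦ _ _ (hY_cont z) (hY_cont z') _ dist_nonneg (hY_sub z z') t ht
  obtain ⟨z, hz⟩ : ∃ z, Φ' z = z := ⟨_, hΦ'.fixedPoint_isFixedPt⟩
  refine ⟨Y z, hY_cont z, fun t ht => ?_⟩
  have hz_apply : (w t)⁻¹ • Φ (Y z) t = z ⟨t, ht⟩ := DFunLike.congr_fun hz ⟨t, ht⟩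
  rw [hY z ⟨t, ht⟩, ← hz_apply]
  exact smul_inv_smul₀ (hw_pos t ht).ne' _

theorem exists_eq_integral_linear [CompleteSpace E] (hab : a ≤ b) {A : ℝ → E →L[ℝ] E} {β : ℝ → E}
    (hA : IntervalIntegrable A volume a b) (hβ : IntervalIntegrable β volume a b) (y₀ : E) :
    ∃ y : ℝ → E, IntervalIntegrable (fun s => A s (y s) + β s) volume a b ∧
      ∀ t ∈ Icc a b, y t = y₀ + ∫ s in a..t, (A s (y s) + β s) := by
  have h_int : ∀ y, ContinuousOn y (Icc a b) →
      IntervalIntegrable (fun s => A s (y s) + β s) volume a b := fun y hy =>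
    (intervalIntegrable_clm_apply hA (by rwa [uIcc_of_le hab])).add hβ
  -- For the Bielecki weight `exp (2 ∫ ‖A‖)` the Picard map is a contraction on all of `[a, b]`.
  obtain ⟨y, hy_cont, hy⟩ := exists_eq_of_weighted_contraction isCompact_Icc
    (w := fun t => Real.exp (2 * ∫ s in a..t, ‖A s‖)) (K := 1 / 2)
    (Φ := fun y t => y₀ + ∫ s in a..t, (A s (y s) + β s))
    ((continuousOn_Icc_primitive hab hA.norm).const_mul 2).rexp (fun t _ => Real.exp_pos _)
    (by norm_num) (fun y hy => (continuousOn_Icc_primitive hab (h_int y hy)).const_add y₀)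
    fun y z hy hz C hC hyz t ht => by
      have h_sub : uIcc a t ⊆ uIcc a b := uIcc_subset_uIcc_left (by rwa [uIcc_of_le hab])
      have h_diff : (y₀ + ∫ s in a..t, (A s (y s) + β s)) - (y₀ + ∫ s in a..t, (A s (z s) + β s))
          = ∫ s in a..t, A s (y s - z s) := by
        rw [add_sub_add_left_eq_sub, ← intervalIntegral.integral_sub
          ((h_int y hy).mono_set h_sub) ((h_int z hz).mono_set h_sub)]
        simp
      rw [h_diff]
      refine (norm_integral_clm_apply_le ht.1 (hA.mono_set h_sub) hC fun s hs =>
        hyz s ⟨hs.1, hs.2.trans ht.2⟩).trans_eq ?_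
      push_cast
      ring
  exact ⟨y, h_int y hy_cont, hy⟩

theorem exists_eq_integral_linear_backward [CompleteSpace E] (hab : a ≤ b) {A : ℝ → E →L[ℝ] E}
    {β : ℝ → E} (hA : IntervalIntegrable A volume a b) (hβ : IntervalIntegrable β volume a b)
    (y₁ : E) :
    ∃ y : ℝ → E, IntervalIntegrable (fun s => A s (y s) + β s) volume a b ∧
      ∀ t ∈ Icc a b, y t = y₁ + ∫ s in t..b, (A s (y s) + β s) := by
  obtain ⟨y, hy_int, hy⟩ := exists_eq_integral_linear hab (A := fun s => A (a + b - s))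
    (β := fun s => β (a + b - s)) (by simpa using (hA.comp_sub_left (a + b)).symm)
    (by simpa using (hβ.comp_sub_left (a + b)).symm) y₁
  refine ⟨fun t => y (a + b - t), by simpa using (hy_int.comp_sub_left (a + b)).symm,
    fun t ht => ?_⟩
  beta_reduce
  rw [hy (a + b - t) ⟨by linarith [ht.2], by linarith [ht.1]⟩]
  have h_reflect := intervalIntegral.integral_comp_sub_left (a := t) (b := b)
    (fun s => A (a + b - s) (y s) + β (a + b - s)) (a + b)
  simpa using h_reflect.symm

end LinearCaratheodory

section SignedMeasure

variable {E F : Type*} [MeasurableSpace E] [NormedAddCommGroup F] [NormedSpace ℝ F]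

theorem exists_probabilityMeasure_toSignedMeasure_eq {σ : SignedMeasure E} (hσ : 0 ≤ σ)
    (hσ_univ : σ univ = 1) : ∃ ν : ProbabilityMeasure E, (ν : Measure E).toSignedMeasure = σ := by
  have hσ_restrict := (VectorMeasure.le_restrict_univ_iff_le _ _).2 hσ
  have h_eq := SignedMeasure.toMeasureOfZeroLE_toSignedMeasure σ hσ_restrict
  refine ⟨⟨σ.toMeasureOfZeroLE univ .univ hσ_restrict, ⟨?_⟩⟩, h_eq⟩
  rwa [← h_eq, Measure.toSignedMeasure_apply_measurable .univ, measureReal_def,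
    ENNReal.toReal_eq_one_iff] at hσ_univ

theorem integral_toSignedMeasure_sub {g : E → F} {μ ν : Measure E}
    [IsFiniteMeasure μ] [IsFiniteMeasure ν] (hν : Integrable g ν) (hμ : Integrable g μ) :
    ∫ᵛ u, g u ∂<•(ν.toSignedMeasure - μ.toSignedMeasure) = ∫ u, g u ∂ν - ∫ u, g u ∂μ := by
  rw [VectorMeasure.integral_sub_vectorMeasure, VectorMeasure.integral_toSignedMeasure,
    VectorMeasure.integral_toSignedMeasure]
  · simpa [VectorMeasure.Integrable] using hν
  · simpa [VectorMeasure.Integrable] using hμ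

end SignedMeasure

theorem integral_adjoint {H₁ H₂ Ω : Type*} [NormedAddCommGroup H₁] [InnerProductSpace ℝ H₁]
    [CompleteSpace H₁] [NormedAddCommGroup H₂] [InnerProductSpace ℝ H₂] [CompleteSpace H₂]
    [MeasurableSpace Ω] {μ : Measure Ω} (B : Ω → H₁ →L[ℝ] H₂) :
    ∫ u, ContinuousLinearMap.adjoint (B u) ∂μ = ContinuousLinearMap.adjoint (∫ u, B u ∂μ) :=
  (ContinuousLinearMap.adjoint (𝕜 := ℝ) (E := H₁) (F := H₂)).toContinuousLinearEquiv
    |>.integral_comp_comm B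

theorem continuousOn_uncurry_inner {H X Y : Type*} [NormedAddCommGroup H] [InnerProductSpace ℝ H]
    [TopologicalSpace X] [TopologicalSpace Y] {I : Set X} {U : Set Y} {p : X → H} {g : X → Y → H}
    (hp : ContinuousOn p I) (hg : ContinuousOn (Function.uncurry g) (I ×ˢ U)) :
    ContinuousOn (Function.uncurry fun t u => inner ℝ (p t) (g t u)) (I ×ˢ U) :=
  (hp.comp continuousOn_fst fun _ hq => hq.1).inner hg

theorem continuousOn_of_norm_sub_le {X Y F : Type*} [NormedAddCommGroup X]
    [NormedAddCommGroup Y] [NormedAddCommGroup F] {I : Set ℝ} {U : Set Y} {L : ℝ}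
    {g : ℝ → X → Y → F}
    (hg : ∀ t₁ ∈ I, ∀ t₂ ∈ I, ∀ x₁ x₂, ∀ u₁ ∈ U, ∀ u₂ ∈ U,
      ‖g t₁ x₁ u₁ - g t₂ x₂ u₂‖ ≤ L * (|t₁ - t₂| + ‖x₁ - x₂‖ + ‖u₁ - u₂‖)) :
    ContinuousOn (fun q : ℝ × X × Y => g q.1 q.2.1 q.2.2) (I ×ˢ univ ×ˢ U) := by
  rintro ⟨t₀, x₀, u₀⟩ ⟨ht₀, -, hu₀⟩
  refine tendsto_iff_norm_sub_tendsto_zero.2 (squeeze_zero' (.of_forall fun _ => norm_nonneg _)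
    (g := fun q => L * (|q.1 - t₀| + ‖q.2.1 - x₀‖ + ‖q.2.2 - u₀‖)) ?_ ?_)
  · filter_upwards [self_mem_nhdsWithin] with q hq
    exact hg _ hq.1 _ ht₀ _ _ _ hq.2.2 _ hu₀
  · have h_cont : Continuous fun q : ℝ × X × Y =>
        L * (|q.1 - t₀| + ‖q.2.1 - x₀‖ + ‖q.2.2 - u₀‖) := by fun_prop
    simpa using (h_cont.tendsto (t₀, x₀, u₀)).mono_left nhdsWithin_le_nhds

section ImageOptimization

variable {α β : Type*}

theorem isLeast_sInf_image_of_isMinOn {f : α → ℝ} {s : Set α} {z : α} (hz : z ∈ s)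
    (hmin : IsMinOn f s z) : IsLeast (f '' s) (sInf (f '' s)) := by
  have h_least : IsLeast (f '' s) (f z) :=
    ⟨mem_image_of_mem f hz, forall_mem_image.2 (isMinOn_iff.1 hmin)⟩
  rwa [h_least.csInf_eq]

theorem isMinOn_iff_isMinOn_image_of_eqOn {γ : Type*} [Preorder γ] {f : α → γ} {g : β → γ}
    {π : α → β} {s : Set α} (hfg : EqOn f (g ∘ π) s) {z : α} (hz : z ∈ s) :
    IsMinOn f s z ↔ IsMinOn g (π '' s) (π z) := by
  simp only [isMinOn_iff, forall_mem_image, hfg hz, Function.comp_apply]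
  exact forall₂_congr fun w hw => by rw [hfg hw, Function.comp_apply]

end ImageOptimization

namespace RelaxedProblem

variable {n m : ℕ} {P : RelaxedProblem n m}
  {μ ν : ℝ → ProbabilityMeasure (EuclideanSpace ℝ (Fin m))}
  {δμ : ℝ → SignedMeasure (EuclideanSpace ℝ (Fin m))}

/-- The variation `δμ_t = ν_t - μ_t` that carries the input `μ` to the input `ν`. Up to a null set
of times, the admissible variations of `μ` are those for which `ν` is a relaxed input. -/
noncomputable def variationTo (μ ν : ℝ → ProbabilityMeasure (EuclideanSpace ℝ (Fin m))) (t : ℝ) :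
    SignedMeasure (EuclideanSpace ℝ (Fin m)) :=
  (ν t : Measure (EuclideanSpace ℝ (Fin m))).toSignedMeasure -
    (μ t : Measure (EuclideanSpace ℝ (Fin m))).toSignedMeasure

theorem IsRelaxedInput.ae_ae_mem (hμ : P.IsRelaxedInput μ) :
    ∀ᵐ t ∂volume.restrict (Icc 0 P.T),
      ∀ᵐ u ∂(μ t : Measure (EuclideanSpace ℝ (Fin m))), u ∈ P.U := by
  filter_upwards [hμ.2] with t ht
  filter_upwards [Measure.support_mem_ae] with u hu using ht hu

theorem isRelaxedInput_diracProba (hU : IsClosed P.U) {s : ℝ → EuclideanSpace ℝ (Fin m)}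
    (hs : Measurable s) (hsU : ∀ t ∈ Icc 0 P.T, s t ∈ P.U) :
    P.IsRelaxedInput fun t => diracProba (s t) := by
  refine ⟨fun B hB => ((Measure.measurable_coe hB).comp
    (Measure.measurable_dirac.comp hs)).aemeasurable, ?_⟩
  filter_upwards [ae_restrict_mem measurableSet_Icc] with t ht
  exact Measure.support_subset_of_isClosed hU
    ((mem_ae_dirac_iff hU.measurableSet).2 (hsU t ht))

theorem isVariation_variationTo (hμ : P.IsRelaxedInput μ) (hν : P.IsRelaxedInput ν) :
    P.IsVariation μ (variationTo μ ν) := by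
  refine ⟨fun B hB => ?_, ?_⟩
  · refine ((hν.1 B hB).ennreal_toReal.sub (hμ.1 B hB).ennreal_toReal).congr
      (.of_forall fun t => ?_)
    simp [variationTo, hB, measureReal_def]
  · filter_upwards [hν.2] with t ht
    simpa [variationTo, sub_add_cancel, Measure.variation_toSignedMeasure, ht] using
      Measure.zero_le_toSignedMeasure (ν t : Measure (EuclideanSpace ℝ (Fin m)))

theorem IsVariation.exists_ae_eq_variationTo (hδ : P.IsVariation μ δμ) (hμ : P.IsRelaxedInput μ) :
    ∃ ν, P.IsRelaxedInput ν ∧ δμ =ᵐ[volume.restrict (Icc 0 P.T)] variationTo μ ν := by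
  let σ := fun t => δμ t + (μ t : Measure (EuclideanSpace ℝ (Fin m))).toSignedMeasure
  have h_ex : ∀ᵐ t ∂volume.restrict (Icc 0 P.T),
      ∃ ν : ProbabilityMeasure (EuclideanSpace ℝ (Fin m)),
        (ν : Measure (EuclideanSpace ℝ (Fin m))).toSignedMeasure = σ t := by
    filter_upwards [hδ.2] with t ⟨_, h_nonneg, h_univ⟩
    exact exists_probabilityMeasure_toSignedMeasure_eq h_nonneg (by simp [σ, h_univ])
  have : Nonempty (ProbabilityMeasure (EuclideanSpace ℝ (Fin m))) := ⟨μ 0⟩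
  obtain ⟨ν, hν⟩ := Filter.skolem.1 h_ex
  refine ⟨ν, ⟨fun B hB => ?_, ?_⟩, ?_⟩
  · have hσ : AEMeasurable (fun t => ENNReal.ofReal (σ t B)) (volume.restrict (Icc 0 P.T)) := by
      refine ((hδ.1 B hB).add (hμ.1 B hB).ennreal_toReal).ennreal_ofReal.congr
        (.of_forall fun t => ?_)
      simp [σ, hB, measureReal_def]
    refine hσ.congr ?_
    filter_upwards [hν] with t ht
    rw [← ht, Measure.toSignedMeasure_apply_measurable hB, ofReal_measureReal]
  · filter_upwards [hν, hδ.2] with t ht ⟨h_supp, _⟩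
    change (σ t).variation.support ⊆ P.U at h_supp
    rwa [← ht, Measure.variation_toSignedMeasure] at h_supp
  · filter_upwards [hν] with t ht
    simp [variationTo, ht, σ]

section Averages

variable {F : Type*} [NormedAddCommGroup F] {g : ℝ → EuclideanSpace ℝ (Fin m) → F}

theorem IsRelaxedInput.ae_integrable (hμ : P.IsRelaxedInput μ) (hU : IsCompact P.U)
    (hg : ContinuousOn (Function.uncurry g) (Icc 0 P.T ×ˢ P.U)) :
    ∀ᵐ t ∂volume.restrict (Icc 0 P.T),
      Integrable (g t) (μ t : Measure (EuclideanSpace ℝ (Fin m))) := by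
  filter_upwards [hμ.ae_ae_mem, ae_restrict_mem measurableSet_Icc] with t hμt ht
  exact integrable_of_continuousOn_of_ae_mem hU
    (hg.comp (f := fun u => (t, u)) (by fun_prop) fun u hu => ⟨ht, hu⟩) hμt

variable [NormedSpace ℝ F]

theorem IsRelaxedInput.integrableOn_integral (hμ : P.IsRelaxedInput μ) (hU : IsCompact P.U)
    (hg : ContinuousOn (Function.uncurry g) (Icc 0 P.T ×ˢ P.U)) :
    IntegrableOn (fun t => ∫ u, g t u ∂(μ t : Measure (EuclideanSpace ℝ (Fin m)))) (Icc 0 P.T) :=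
  integrable_integral_of_continuousOn hμ.1 isCompact_Icc hU hg
    (ae_restrict_mem measurableSet_Icc) hμ.ae_ae_mem

theorem ae_integral_variationTo (hμ : P.IsRelaxedInput μ) (hν : P.IsRelaxedInput ν)
    (hU : IsCompact P.U) (hg : ContinuousOn (Function.uncurry g) (Icc 0 P.T ×ˢ P.U)) :
    ∀ᵐ t ∂volume.restrict (Icc 0 P.T), ∫ᵛ u, g t u ∂<•(variationTo μ ν t) =
      ∫ u, g t u ∂(ν t : Measure (EuclideanSpace ℝ (Fin m))) -
        ∫ u, g t u ∂(μ t : Measure (EuclideanSpace ℝ (Fin m))) := by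
  filter_upwards [hν.ae_integrable hU hg, hμ.ae_integrable hU hg] with t hνt hμt
  exact integral_toSignedMeasure_sub hνt hμt

theorem IsVariation.integrableOn_integral (hδ : P.IsVariation μ δμ) (hμ : P.IsRelaxedInput μ)
    (hU : IsCompact P.U) (hg : ContinuousOn (Function.uncurry g) (Icc 0 P.T ×ˢ P.U)) :
    IntegrableOn (fun t => ∫ᵛ u, g t u ∂<•(δμ t)) (Icc 0 P.T) := by
  obtain ⟨ν, hν, hδν⟩ := hδ.exists_ae_eq_variationTo hμ
  refine ((hν.integrableOn_integral hU hg).sub (hμ.integrableOn_integral hU hg)).congr ?_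
  filter_upwards [hδν, ae_integral_variationTo hμ hν hU hg] with t hδt hνt
  rw [hδt, hνt, Pi.sub_apply]

end Averages

theorem exists_isRelaxedInput_forall_integral_le (hT : 0 ≤ P.T) (hU : IsCompact P.U)
    (hne : P.U.Nonempty) {g : ℝ → EuclideanSpace ℝ (Fin m) → ℝ}
    (hg : ContinuousOn (Function.uncurry g) (Icc 0 P.T ×ˢ P.U)) :
    ∃ ν, P.IsRelaxedInput ν ∧ ∀ ν', P.IsRelaxedInput ν' →
      ∫ t in (0 : ℝ)..P.T, ∫ u, g t u ∂(ν t : Measure (EuclideanSpace ℝ (Fin m))) ≤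
        ∫ t in (0 : ℝ)..P.T, ∫ u, g t u ∂(ν' t : Measure (EuclideanSpace ℝ (Fin m))) := by
  obtain ⟨s, hs, hs_argmin⟩ := exists_measurable_argmin isCompact_Icc hU hne hg
  have hν := isRelaxedInput_diracProba hU.isClosed hs fun t ht => (hs_argmin t ht).1
  refine ⟨_, hν, fun ν' hν' => ?_⟩
  simp only [intervalIntegral.integral_of_le hT, ← integral_Icc_eq_integral_Ioc]
  refine integral_mono_ae (hν.integrableOn_integral hU hg) (hν'.integrableOn_integral hU hg) ?_
  filter_upwards [ae_restrict_mem measurableSet_Icc, hν'.ae_ae_mem, hν'.ae_integrable hU hg]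
    with t ht h_mem h_int
  calc ∫ u, g t u ∂(Measure.dirac (s t))
      = ∫ _u, g t (s t) ∂(ν' t : Measure (EuclideanSpace ℝ (Fin m))) := by simp
    _ ≤ ∫ u, g t u ∂(ν' t : Measure (EuclideanSpace ℝ (Fin m))) :=
      integral_mono_ae (integrable_const _) h_int
        (h_mem.mono fun u hu => isMinOn_iff.1 (hs_argmin t ht).2 u hu)

variable {x p : ℝ → EuclideanSpace ℝ (Fin n)}

theorem IsTrajectory.continuousOn (hT : 0 ≤ P.T) (hx : P.IsTrajectory μ x) :
    ContinuousOn x (Icc 0 P.T) :=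
  ((continuousOn_Icc_primitive hT hx.1).const_add P.ξ).congr hx.2

theorem IsVariation.exists_isLinearizedTrajectory (hδ : P.IsVariation μ δμ)
    (hμ : P.IsRelaxedInput μ) (hT : 0 ≤ P.T) (hU : IsCompact P.U)
    (hf : ContinuousOn (Function.uncurry fun t u => P.f t (x t) u) (Icc 0 P.T ×ˢ P.U))
    (hdfdx : ContinuousOn (Function.uncurry fun t u => P.dfdx t (x t) u) (Icc 0 P.T ×ˢ P.U)) :
    ∃ δx, P.IsLinearizedTrajectory x μ δμ δx := by
  have hA := hμ.integrableOn_integral hU hdfdx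
  have hβ := hδ.integrableOn_integral hμ hU hf
  rw [← intervalIntegrable_iff_integrableOn_Icc_of_le hT] at hA hβ
  simpa only [IsLinearizedTrajectory, zero_add] using exists_eq_integral_linear hT hA hβ 0

theorem exists_isCostate (hμ : P.IsRelaxedInput μ) (hT : 0 ≤ P.T) (hU : IsCompact P.U)
    (hdfdx : ContinuousOn (Function.uncurry fun t u => P.dfdx t (x t) u) (Icc 0 P.T ×ˢ P.U)) :
    ∃ p, P.IsCostate x μ p := by
  have hA := hμ.integrableOn_integral hU
    (g := fun t u => ContinuousLinearMap.adjoint (P.dfdx t (x t) u))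
    (ContinuousLinearMap.adjoint.continuous.comp_continuousOn hdfdx)
  rw [← intervalIntegrable_iff_integrableOn_Icc_of_le hT] at hA
  simpa only [IsCostate, add_zero] using
    exists_eq_integral_linear_backward hT hA (β := fun _ => 0) (by simp) (gradient P.Ψ (x P.T))

theorem IsCostate.eq_primitive (hp : P.IsCostate x μ p) {t : ℝ} (ht : t ∈ Icc 0 P.T) :
    p t = p 0 + ∫ s in (0 : ℝ)..t, -((∫ u, ContinuousLinearMap.adjoint (P.dfdx s (x s) u)
      ∂(μ s : Measure (EuclideanSpace ℝ (Fin m)))) (p s)) := by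
  have hT : 0 ≤ P.T := ht.1.trans ht.2
  have ht' : t ∈ uIcc 0 P.T := by rwa [uIcc_of_le hT]
  rw [hp.2 t ht, hp.2 0 ⟨le_rfl, hT⟩, intervalIntegral.integral_neg,
    ← intervalIntegral.integral_add_adjacent_intervals
      (hp.1.mono_set (uIcc_subset_uIcc_left ht')) (hp.1.mono_set (uIcc_subset_uIcc_right ht'))]
  abel

theorem IsCostate.continuousOn (hT : 0 ≤ P.T) (hp : P.IsCostate x μ p) :
    ContinuousOn p (Icc 0 P.T) :=
  ((continuousOn_Icc_primitive hT hp.1.neg).const_add (p 0)).congr fun _ ht => hp.eq_primitive ht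

theorem IsCostate.linCost_eq_hamCost (hp : P.IsCostate x μ p) (hT : 0 ≤ P.T)
    {δx : ℝ → EuclideanSpace ℝ (Fin n)} (hδx : P.IsLinearizedTrajectory x μ δμ δx) :
    P.linCost x (δx, δμ) = P.hamCost x p δμ := by
  have hpT : p P.T = gradient P.Ψ (x P.T) := by
    rw [hp.2 P.T ⟨hT, le_rfl⟩, intervalIntegral.integral_same, add_zero]
  have hδx0 : δx 0 = 0 := by rw [hδx.2 0 ⟨le_rfl, hT⟩, intervalIntegral.integral_same]
  have h_parts := integral_inner_add_inner_of_eq_primitive hp.1.neg hδx.1 (a₀ := p 0) (b₀ := 0)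
    (F := p) (G := δx) (fun t ht => hp.eq_primitive (by rwa [uIcc_of_le hT] at ht))
    (fun t ht => by rw [hδx.2 t (by rwa [uIcc_of_le hT] at ht), zero_add])
  rw [hδx0, inner_zero_right, sub_zero, hpT] at h_parts
  rw [linCost, ← h_parts, hamCost]
  refine intervalIntegral.integral_congr fun t _ => ?_
  simp only [Pi.neg_apply]
  rw [integral_adjoint, hamiltonian, inner_add_right, inner_neg_left,
    ContinuousLinearMap.adjoint_inner_left, neg_add_cancel_left]

theorem hamCost_eq_of_ae_eq_variationTo (hμ : P.IsRelaxedInput μ) (hν : P.IsRelaxedInput ν)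
    (hδ : δμ =ᵐ[volume.restrict (Icc 0 P.T)] variationTo μ ν) (hT : 0 ≤ P.T) (hU : IsCompact P.U)
    (hf : ContinuousOn (Function.uncurry fun t u => P.f t (x t) u) (Icc 0 P.T ×ˢ P.U))
    (hp : ContinuousOn p (Icc 0 P.T)) :
    P.hamCost x p δμ =
      (∫ t in (0 : ℝ)..P.T, ∫ u, inner ℝ (p t) (P.f t (x t) u)
        ∂(ν t : Measure (EuclideanSpace ℝ (Fin m)))) -
      ∫ t in (0 : ℝ)..P.T, ∫ u, inner ℝ (p t) (P.f t (x t) u)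
        ∂(μ t : Measure (EuclideanSpace ℝ (Fin m))) := by
  have hg := continuousOn_uncurry_inner hp hf
  simp only [hamCost, intervalIntegral.integral_of_le hT, ← integral_Icc_eq_integral_Ioc]
  rw [← integral_sub (hν.integrableOn_integral hU hg) (hμ.integrableOn_integral hU hg)]
  refine integral_congr_ae ?_
  filter_upwards [hδ, ae_integral_variationTo hμ hν hU hf, hν.ae_integrable hU hf,
    hμ.ae_integrable hU hf] with t hδt h_sub hνt hμt
  rw [hamiltonian, hδt, h_sub, inner_sub_right, integral_inner hνt, integral_inner hμt]

theorem hamMinimizers_nonempty (hμ : P.IsRelaxedInput μ) (hT : 0 ≤ P.T) (hU : IsCompact P.U)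
    (hne : P.U.Nonempty)
    (hf : ContinuousOn (Function.uncurry fun t u => P.f t (x t) u) (Icc 0 P.T ×ˢ P.U))
    (hp : ContinuousOn p (Icc 0 P.T)) : (P.hamMinimizers x μ p).Nonempty := by
  obtain ⟨ν, hν, hν_min⟩ := exists_isRelaxedInput_forall_integral_le hT hU hne
    (continuousOn_uncurry_inner hp hf)
  refine ⟨variationTo μ ν, isVariation_variationTo hμ hν, isMinOn_iff.2 fun δμ hδ => ?_⟩
  obtain ⟨ν', hν', hδν'⟩ := IsVariation.exists_ae_eq_variationTo hδ hμ
  rw [hamCost_eq_of_ae_eq_variationTo hμ hν .rfl hT hU hf hp,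
    hamCost_eq_of_ae_eq_variationTo hμ hν' hδν' hT hU hf hp]
  exact sub_le_sub_right (hν_min ν' hν') _

theorem snd_image_linFeasible (hμ : P.IsRelaxedInput μ) (hT : 0 ≤ P.T) (hU : IsCompact P.U)
    (hf : ContinuousOn (Function.uncurry fun t u => P.f t (x t) u) (Icc 0 P.T ×ˢ P.U))
    (hdfdx : ContinuousOn (Function.uncurry fun t u => P.dfdx t (x t) u) (Icc 0 P.T ×ˢ P.U)) :
    Prod.snd '' P.linFeasible x μ = P.hamFeasible μ := by
  refine Subset.antisymm (image_subset_iff.2 fun _ hz => hz.1) fun δμ hδ => ?_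
  obtain ⟨δx, hδx⟩ := IsVariation.exists_isLinearizedTrajectory hδ hμ hT hU hf hdfdx
  exact ⟨(δx, δμ), ⟨hδ, hδx⟩, rfl⟩

theorem IsCostate.eqOn_linCost_hamCost (hp : P.IsCostate x μ p) (hT : 0 ≤ P.T) :
    EqOn (P.linCost x) (P.hamCost x p ∘ Prod.snd) (P.linFeasible x μ) := fun _ hz =>
  hp.linCost_eq_hamCost hT hz.2

theorem IsCostate.linMinimizers_eq (hp : P.IsCostate x μ p) (hT : 0 ≤ P.T)
    (h_snd : Prod.snd '' P.linFeasible x μ = P.hamFeasible μ) :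
    P.linMinimizers x μ = P.linFeasible x μ ∩ Prod.snd ⁻¹' P.hamMinimizers x μ p := by
  ext z
  refine and_congr_right fun hz => ?_
  rw [isMinOn_iff_isMinOn_image_of_eqOn (hp.eqOn_linCost_hamCost hT) hz, h_snd]
  exact (and_iff_right hz.1).symm

/-- The data are `C¹` in the state: the qualitative counterpart of `LipschitzC1`, asking for joint
continuity of `f` and `∂f/∂x` on `[0, T] × ℝⁿ × U` in place of Lipschitz bounds. -/
structure IsContinuousC1 (P : RelaxedProblem n m) : Prop where
  differentiable_Ψ : Differentiable ℝ P.Ψ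
  differentiableAt_f :
    ∀ t ∈ Icc 0 P.T, ∀ x, ∀ u ∈ P.U, DifferentiableAt ℝ (fun y => P.f t y u) x
  continuousOn_f : ContinuousOn (fun q : ℝ × EuclideanSpace ℝ (Fin n) × EuclideanSpace ℝ (Fin m) =>
    P.f q.1 q.2.1 q.2.2) (Icc 0 P.T ×ˢ univ ×ˢ P.U)
  continuousOn_dfdx :
    ContinuousOn (fun q : ℝ × EuclideanSpace ℝ (Fin n) × EuclideanSpace ℝ (Fin m) =>
      P.dfdx q.1 q.2.1 q.2.2) (Icc 0 P.T ×ˢ univ ×ˢ P.U)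

theorem LipschitzC1.isContinuousC1 (hP : P.LipschitzC1) : P.IsContinuousC1 := by
  obtain ⟨hΨ, hdiff, L, -, -, -, hL⟩ := hP
  refine ⟨hΨ, fun t ht x u hu => (hdiff t ht x u hu).1, ?_, ?_⟩
  · exact continuousOn_of_norm_sub_le fun t₁ h₁ t₂ h₂ x₁ x₂ u₁ hu₁ u₂ hu₂ =>
      (hL t₁ h₁ t₂ h₂ x₁ x₂ u₁ hu₁ u₂ hu₂).1
  · exact continuousOn_of_norm_sub_le fun t₁ h₁ t₂ h₂ x₁ x₂ u₁ hu₁ u₂ hu₂ =>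
      (hL t₁ h₁ t₂ h₂ x₁ x₂ u₁ hu₁ u₂ hu₂).2.1

theorem continuousOn_graph (hx : ContinuousOn x (Icc 0 P.T)) :
    ContinuousOn (fun q : ℝ × EuclideanSpace ℝ (Fin m) => (q.1, x q.1, q.2))
      (Icc 0 P.T ×ˢ P.U) :=
  continuousOn_fst.prodMk
    ((hx.comp continuousOn_fst fun _ hq => hq.1).prodMk continuousOn_snd)

theorem IsContinuousC1.continuousOn_f_comp (hP : P.IsContinuousC1)
    (hx : ContinuousOn x (Icc 0 P.T)) :
    ContinuousOn (Function.uncurry fun t u => P.f t (x t) u) (Icc 0 P.T ×ˢ P.U) :=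
  hP.continuousOn_f.comp (continuousOn_graph hx) fun _ hq => ⟨hq.1, mem_univ _, hq.2⟩

theorem IsContinuousC1.continuousOn_dfdx_comp (hP : P.IsContinuousC1)
    (hx : ContinuousOn x (Icc 0 P.T)) :
    ContinuousOn (Function.uncurry fun t u => P.dfdx t (x t) u) (Icc 0 P.T ×ˢ P.U) :=
  hP.continuousOn_dfdx.comp (continuousOn_graph hx) fun _ hq => ⟨hq.1, mem_univ _, hq.2⟩

end RelaxedProblem

theorem mainTheorem1_general {n m : ℕ} (P : RelaxedProblem n m)
    (hT : 0 ≤ P.T) (hUne : P.U.Nonempty) (hUcomp : IsCompact P.U) (hreg : P.IsContinuousC1)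
    (μ : ℝ → ProbabilityMeasure (EuclideanSpace ℝ (Fin m))) (hμ : P.IsRelaxedInput μ)
    (x : ℝ → EuclideanSpace ℝ (Fin n)) (hx : P.IsTrajectory μ x) :
    (∃ p : ℝ → EuclideanSpace ℝ (Fin n), P.IsCostate x μ p) ∧
    ∀ p : ℝ → EuclideanSpace ℝ (Fin n), P.IsCostate x μ p →
      IsLeast (P.linCost x '' P.linFeasible x μ) (P.thetaL x μ) ∧
      IsLeast (P.hamCost x p '' P.hamFeasible μ) (P.thetaH x μ p) ∧
      P.thetaL x μ = P.thetaH x μ p ∧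
      Prod.snd '' P.linMinimizers x μ = P.hamMinimizers x μ p ∧
      ∀ (δx : ℝ → EuclideanSpace ℝ (Fin n))
        (δμ : ℝ → SignedMeasure (EuclideanSpace ℝ (Fin m))),
        (δx, δμ) ∈ P.linMinimizers x μ ↔
          P.IsLinearizedTrajectory x μ δμ δx ∧ δμ ∈ P.hamMinimizers x μ p := by
  have hf := hreg.continuousOn_f_comp (hx.continuousOn hT)
  have hdfdx := hreg.continuousOn_dfdx_comp (hx.continuousOn hT)
  refine ⟨RelaxedProblem.exists_isCostate hμ hT hUcomp hdfdx, fun p hp => ?_⟩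
  have h_snd := RelaxedProblem.snd_image_linFeasible hμ hT hUcomp hf hdfdx
  have h_min := hp.linMinimizers_eq hT h_snd
  have h_image : P.linCost x '' P.linFeasible x μ = P.hamCost x p '' P.hamFeasible μ := by
    rw [← h_snd, ← image_comp, (hp.eqOn_linCost_hamCost hT).image_eq]
  have h_theta : P.thetaL x μ = P.thetaH x μ p := congrArg sInf h_image
  obtain ⟨δμ, hδ, hδ_min⟩ :=
    RelaxedProblem.hamMinimizers_nonempty hμ hT hUcomp hUne hf (hp.continuousOn hT)
  have h_least : IsLeast (P.hamCost x p '' P.hamFeasible μ) (P.thetaH x μ p) :=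
    isLeast_sInf_image_of_isMinOn hδ hδ_min
  refine ⟨by rwa [h_image, h_theta], h_least, h_theta, ?_, fun δx δμ => ?_⟩
  · rw [h_min, image_inter_preimage, h_snd]
    exact inter_eq_right.2 fun _ h => h.1
  · rw [h_min]
    exact ⟨fun h => ⟨h.1.2, h.2⟩, fun h => ⟨⟨h.2.1, h.1⟩, h.2⟩⟩

theorem mainTheorem1 {n m : ℕ} (P : RelaxedProblem n m)
    (hT : 0 < P.T) (hUconn : IsConnected P.U) (hUcomp : IsCompact P.U) (hreg : P.LipschitzC1)
    (μ : ℝ → ProbabilityMeasure (EuclideanSpace ℝ (Fin m))) (hμ : P.IsRelaxedInput μ)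
    (x : ℝ → EuclideanSpace ℝ (Fin n)) (hx : P.IsTrajectory μ x) :
    (∃ p : ℝ → EuclideanSpace ℝ (Fin n), P.IsCostate x μ p) ∧
    ∀ p : ℝ → EuclideanSpace ℝ (Fin n), P.IsCostate x μ p →
      -- both minima are attained
      IsLeast (P.linCost x '' P.linFeasible x μ) (P.thetaL x μ) ∧
      IsLeast (P.hamCost x p '' P.hamFeasible μ) (P.thetaH x μ p) ∧
      -- the values agree
      P.thetaL x μ = P.thetaH x μ p ∧
      -- the minimizing variations agree
      Prod.snd '' P.linMinimizers x μ = P.hamMinimizers x μ p ∧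
      ∀ (δx : ℝ → EuclideanSpace ℝ (Fin n))
        (δμ : ℝ → SignedMeasure (EuclideanSpace ℝ (Fin m))),
        (δx, δμ) ∈ P.linMinimizers x μ ↔
          P.IsLinearizedTrajectory x μ δμ δx ∧ δμ ∈ P.hamMinimizers x μ p := by
  exact mainTheorem1_general P hT.le hUconn.nonempty hUcomp hreg.isContinuousC1 μ hμ x hx
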